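/- Let $R$ be an associative ring with identity. Modules are left $R$-modules and complexes are cochain complexes $\cdots\to X^{i-1}\to X^{i}\to X^{i+1}\to\cdots$ indexed by $i\in\mathbb{Z}$. A short exact sequence $0\to A\to B\to C\to 0$ of $R$-modules is pure exact if $0\to M\otimes_R A\to M\otimes_R B\to M\otimes_R C\to 0$ is exact for every right $R$-module $M$; then $A\to B$ is called pure monic and $B\to C$ pure epic. A module is pure projective if it is projective with respect to all pure exact sequences. A complex $X$ is pure exact if for every $n\in\mathbb{Z}$ the differentials $d^{n-1}$ and $d^{n}$ each factor as a pure epic map followed by a pure monic map and the sequence $0\to\operatorname{Ker} d^{n}\to X^{n}\to\operatorname{Coker} d^{n-1}\to 0$ is pure exact. (The same definitions apply over the ring $\mathbb{Z}$.) A cochain map is a pure quasi-isomorphism if its mapping cone is pure exact. For complexes $X,Y$ of $R$-modules, $\operatorname{Hom}_R(X,Y)$ is the total complex of $\mathbb{Z}$-modules with $\prod_{i\in\mathbb{Z}}\operatorname{Hom}_R(X^{i},Y^{i+n})$ in degree $n$ and differential $\varphi\mapsto (d_Y^{i+n}\varphi^{i}-(-1)^{n}\varphi^{i+1}d_X^{i})_{i\in\mathbb{Z}}$.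 Theorem 5.1. Let $X$ be a bounded below complex of $R$-modules, that is, there is $n\in\mathbb{Z}$ with $X^{i}=0$ for all $i<n$. Then $X$ has a pure projective resolution: there exist a complex $P$ all of whose terms $P^{i}$ are pure projective $R$-modules and a cochain map $f:P\to X$ such that (1) $f$ is a pure quasi-isomorphism, and (2) $\operatorname{Hom}_R(P,-)$ preserves pure exact complexes: for every pure exact complex $Y$ of $R$-modules, $\operatorname{Hom}_R(P,Y)$ is a pure exact complex of $\mathbb{Z}$-modules. -/

import Mathlib

open CategoryTheory CategoryTheory.Limits
open scoped TensorProduct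

universe u v

namespace PureComplex

/-! ### The tensor product over an arbitrary ring

A right `R`-module is a left module over the opposite ring `Rᵐᵒᵖ`, so that `x · r` is
`MulOpposite.op r • x`. -/

section Tensor

/-- The subgroup of `M ⊗_ℤ A` generated by the elements `(x · r) ⊗ a - x ⊗ (r · a)`. -/
def balancedRel (R : Type v) [Ring R] (M : Type*) [AddCommGroup M] [Module Rᵐᵒᵖ M]
    (A : Type*) [AddCommGroup A] [Module R A] : AddSubgroup (M ⊗[ℤ] A) :=
  AddSubgroup.closure
    {t | ∃ (x : M) (r : R) (a : A), t = (MulOpposite.op r • x) ⊗ₜ[ℤ] a - x ⊗ₜ[ℤ] (r • a)}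

/-- The abelian group `M ⊗_R A`, for a right `R`-module `M` and a left `R`-module `A`. -/
abbrev BalancedTensor (R : Type v) [Ring R] (M : Type*) [AddCommGroup M] [Module Rᵐᵒᵖ M]
    (A : Type*) [AddCommGroup A] [Module R A] : Type _ :=
  (M ⊗[ℤ] A) ⧸ balancedRel R M A

/-- The map `M ⊗_ℤ f : M ⊗_ℤ A → M ⊗_ℤ B` induced by an `R`-linear map `f : A → B`. -/
def intTensorMap {R : Type v} [Ring R] (M : Type*) [AddCommGroup M]
    {A B : Type*} [AddCommGroup A] [Module R A] [AddCommGroup B] [Module R B] (f : A →ₗ[R] B) :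
    M ⊗[ℤ] A →+ M ⊗[ℤ] B :=
  (TensorProduct.map (LinearMap.id : M →ₗ[ℤ] M)
    f.toAddMonoidHom.toIntLinearMap).toAddMonoidHom

theorem intTensorMap_tmul {R : Type v} [Ring R] {M : Type*} [AddCommGroup M]
    {A B : Type*} [AddCommGroup A] [Module R A] [AddCommGroup B] [Module R B] (f : A →ₗ[R] B)
    (x : M) (a : A) : intTensorMap M f (x ⊗ₜ[ℤ] a) = x ⊗ₜ[ℤ] f a :=
  rfl

theorem balancedRel_le_comap {R : Type v} [Ring R] (M : Type*) [AddCommGroup M] [Module Rᵐᵒᵖ M]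
    {A B : Type*} [AddCommGroup A] [Module R A] [AddCommGroup B] [Module R B] (f : A →ₗ[R] B) :
    balancedRel R M A ≤ (balancedRel R M B).comap (intTensorMap M f) := by
  rw [balancedRel, AddSubgroup.closure_le]
  rintro _ ⟨x, r, a, rfl⟩
  refine AddSubgroup.subset_closure ⟨x, r, f a, ?_⟩
  rw [map_sub, intTensorMap_tmul, intTensorMap_tmul, map_smul]

/-- The map `M ⊗_R f : M ⊗_R A → M ⊗_R B` induced by an `R`-linear map `f : A → B`. -/
def balancedMap {R : Type v} [Ring R] (M : Type*) [AddCommGroup M] [Module Rᵐᵒᵖ M]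
    {A B : Type*} [AddCommGroup A] [Module R A] [AddCommGroup B] [Module R B] (f : A →ₗ[R] B) :
    BalancedTensor R M A →+ BalancedTensor R M B :=
  QuotientAddGroup.map _ _ (intTensorMap M f) (balancedRel_le_comap M f)

end Tensor

/-! ### Purity for modules -/

section Modules

/-- A short exact sequence `0 → A → B → C → 0` of left `R`-modules is pure exact if
`0 → M ⊗_R A → M ⊗_R B → M ⊗_R C → 0` is exact for every right `R`-module `M`. -/
def IsPureShortExact {R : Type v} [Ring R] (S : ShortComplex (ModuleCat.{u} R)) : Prop :=
  S.ShortExact ∧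
    ∀ (M : Type (max u v)) [AddCommGroup M] [Module Rᵐᵒᵖ M],
      Function.Injective (balancedMap M S.f.hom) ∧
      Function.Exact (balancedMap M S.f.hom) (balancedMap M S.g.hom) ∧
      Function.Surjective (balancedMap M S.g.hom)

/-- `f : A → B` is pure monic if it is the first map of a pure exact sequence
`0 → A → B → C → 0`. -/
def IsPureMonic {R : Type v} [Ring R] {A B : ModuleCat.{u} R} (f : A ⟶ B) : Prop :=
  ∃ (C : ModuleCat.{u} R) (g : B ⟶ C) (w : f ≫ g = 0), IsPureShortExact (ShortComplex.mk f g w)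

/-- `g : B → C` is pure epic if it is the second map of a pure exact sequence
`0 → A → B → C → 0`. -/
def IsPureEpic {R : Type v} [Ring R] {B C : ModuleCat.{u} R} (g : B ⟶ C) : Prop :=
  ∃ (A : ModuleCat.{u} R) (f : A ⟶ B) (w : f ≫ g = 0), IsPureShortExact (ShortComplex.mk f g w)

/-- A module `P` is pure projective if it is projective with respect to pure exact sequences:
every map from `P` to the last term of a pure exact sequence `0 → A → B → C → 0` lifts to `B`. -/
def IsPureProjective {R : Type v} [Ring R] (P : ModuleCat.{u} R) : Prop :=
  ∀ S : ShortComplex (ModuleCat.{u} R), IsPureShortExact S →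
    ∀ h : P ⟶ S.X₃, ∃ l : P ⟶ S.X₂, l ≫ S.g = h

end Modules

/-! ### Purity for complexes (with cohomological indexing) -/

section Complexes

/-- A map decomposes if it is a pure epic map followed by a pure monic map. -/
def Decomposes {R : Type v} [Ring R] {A B : ModuleCat.{u} R} (d : A ⟶ B) : Prop :=
  ∃ (D : ModuleCat.{u} R) (p : A ⟶ D) (i : D ⟶ B), IsPureEpic p ∧ IsPureMonic i ∧ p ≫ i = d

/-- The complex `X` is pure exact at `n` if `d^{n-1}` and `d^n` decompose and the sequence
`0 → Ker d^n → X^n → Coker d^{n-1} → 0` is (a complex and) pure exact. -/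
def IsPureExactAt {R : Type v} [Ring R] (X : CochainComplex (ModuleCat.{u} R) ℤ) (n : ℤ) : Prop :=
  Decomposes (X.d (n - 1) n) ∧ Decomposes (X.d n (n + 1)) ∧
    ∃ w : kernel.ι (X.d n (n + 1)) ≫ cokernel.π (X.d (n - 1) n) = 0,
      IsPureShortExact
        (ShortComplex.mk (kernel.ι (X.d n (n + 1))) (cokernel.π (X.d (n - 1) n)) w)

/-- The complex `X` is pure exact if it is pure exact at every `n`. -/
def IsPureExact {R : Type v} [Ring R] (X : CochainComplex (ModuleCat.{u} R) ℤ) : Prop :=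
  ∀ n : ℤ, IsPureExactAt X n

/-- A cochain map is a pure quasi-isomorphism if its mapping cone is pure exact. -/
def IsPureQuasiIso {R : Type v} [Ring R] {X Y : CochainComplex (ModuleCat.{u} R) ℤ}
    (f : X ⟶ Y) : Prop :=
  IsPureExact (CochainComplex.mappingCone f)

/-- The total complex `Hom_R(X, Y)` of `ℤ`-modules, with `∏ i, Hom_R(X^i, Y^{i+n})` in degree `n`
and differential `φ ↦ d_Y ∘ φ - (-1)^n φ ∘ d_X`. -/
noncomputable def homComplex {R : Type v} [Ring R] (X Y : CochainComplex (ModuleCat.{u} R) ℤ) :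
    CochainComplex (ModuleCat.{u} ℤ) ℤ where
  X n := ModuleCat.of ℤ (CochainComplex.HomComplex.Cochain X Y n)
  d n m := ModuleCat.ofHom (CochainComplex.HomComplex.δ_hom ℤ X Y n m)
  shape n m h :=
    ModuleCat.hom_ext (LinearMap.ext fun z => CochainComplex.HomComplex.δ_shape n m h z)
  d_comp_d' n m k _ _ :=
    ModuleCat.hom_ext (LinearMap.ext fun z => CochainComplex.HomComplex.δ_δ n m k z)

/-- `f : P → X` is a pure projective resolution of `X` if `P` consists of pure projective modules,
`f` is a pure quasi-isomorphism, and `Hom_R(P, -)` takes pure exact complexes of `R`-modules to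
pure exact complexes of `ℤ`-modules. -/
structure IsPureProjectiveResolution {R : Type v} [Ring R]
    {P X : CochainComplex (ModuleCat.{u} R) ℤ} (f : P ⟶ X) : Prop where
  pureProjective : ∀ i : ℤ, IsPureProjective (P.X i)
  pureQuasiIso : IsPureQuasiIso f
  preserves : ∀ Y : CochainComplex (ModuleCat.{u} R) ℤ, IsPureExact Y →
    IsPureExact (homComplex P Y)

end Complexes

end PureComplex

/-!
Purity is tested by finitely presented modules: a short exact sequence is pure iff every map from a
finitely presented module `F` into its last term lifts, and a complex is pure exact iff every map
`F → Z^n` lifts along the differential. Hence a map with the right lifting property against the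
inclusions of spheres into disks on finitely presented modules has pure exact mapping cone, and
the small object argument, applied to `0 → X`, produces such a map `P → X` with `P` cofibrant.
Cofibrancy of `P` makes every cocycle from `P` to a pure exact complex a coboundary, and lets
`0`-cochains from `P` lift along degreewise pure epimorphisms. Finally a map from a finitely
presented abelian group `G` to the complex of cochains `P → Y` is a cochain `P → Hom_ℤ(G, Y)`, and
`Hom_ℤ(G, -)` preserves pure exactness because `F ⊗_ℤ G` is finitely presented.
-/

universe w

namespace PureComplex

section BalancedTensor

open MulOpposite

variable {R : Type v} [Ring R] {M : Type*} [AddCommGroup M] [Module Rᵐᵒᵖ M]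
  {A B C : Type*} [AddCommGroup A] [Module R A] [AddCommGroup B] [Module R B]
  [AddCommGroup C] [Module R C]

variable (R) in
/-- The elementary tensor `x ⊗ a` in `M ⊗_R A`. -/
def balancedTmul : M →+ A →+ BalancedTensor R M A where
  toFun x := (QuotientAddGroup.mk' (balancedRel R M A)).comp
    (TensorProduct.mk ℤ M A x).toAddMonoidHom
  map_zero' := by ext; simp
  map_add' x y := by ext; simp

theorem balancedTmul_smul (x : M) (r : R) (a : A) :
    balancedTmul R x (r • a) = balancedTmul R (op r • x) a := by
  refine QuotientAddGroup.eq.2 (AddSubgroup.subset_closure ⟨x, r, a, ?_⟩)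
  rw [neg_add_eq_sub]
  rfl

@[simp]
theorem balancedMap_tmul (f : A →ₗ[R] B) (x : M) (a : A) :
    balancedMap M f (balancedTmul R x a) = balancedTmul R x (f a) :=
  rfl

theorem exists_sum_balancedTmul (t : BalancedTensor R M A) :
    ∃ (n : ℕ) (x : Fin n → M) (a : Fin n → A), t = ∑ i, balancedTmul R (x i) (a i) := by
  obtain ⟨t, rfl⟩ := QuotientAddGroup.mk'_surjective _ t
  obtain ⟨S, rfl⟩ := TensorProduct.exists_finset t
  refine ⟨S.card, fun i => (S.equivFin.symm i).1.1, fun i => (S.equivFin.symm i).1.2, ?_⟩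
  rw [S.equivFin.symm.sum_comp fun i : S => balancedTmul R i.1.1 i.1.2,
    S.sum_coe_sort fun i => balancedTmul R i.1 i.2, map_sum]
  rfl

/-- The map out of `M ⊗_R A` induced by a balanced biadditive map. -/
def balancedLift {T : Type*} [AddCommGroup T] (φ : M →+ A →+ T)
    (hφ : ∀ x (r : R) a, φ (op r • x) a = φ x (r • a)) :
    BalancedTensor R M A →+ T :=
  QuotientAddGroup.lift _
    (TensorProduct.liftAddHom φ fun n x a => by simp only [map_zsmul, AddMonoidHom.smul_apply])
    (by
      rw [balancedRel, AddSubgroup.closure_le]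
      rintro _ ⟨x, r, a, rfl⟩
      simp [hφ])

variable (M) in
theorem map_balancedRel {g : B →ₗ[R] C} (hg : Function.Surjective g) :
    (balancedRel R M B).map (intTensorMap M g) = balancedRel R M C := by
  refine le_antisymm (AddSubgroup.map_le_iff_le_comap.2 (balancedRel_le_comap M g)) ?_
  rw [balancedRel, AddSubgroup.closure_le]
  rintro _ ⟨x, r, c, rfl⟩
  obtain ⟨b, rfl⟩ := hg c
  exact ⟨_, AddSubgroup.subset_closure ⟨x, r, b, rfl⟩, by
    simp only [map_sub, intTensorMap_tmul, map_smul]⟩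

theorem balancedMap_surjective {g : B →ₗ[R] C} (hg : Function.Surjective g) :
    Function.Surjective (balancedMap M g) :=
  QuotientAddGroup.map_surjective_of_surjective _ _ _
    ((QuotientAddGroup.mk'_surjective _).comp
      (LinearMap.lTensor_surjective M (g := g.toAddMonoidHom.toIntLinearMap) hg)) _

theorem balancedMap_exact {f : A →ₗ[R] B} {g : B →ₗ[R] C} (hfg : Function.Exact f g)
    (hg : Function.Surjective g) :
    Function.Exact (balancedMap M f) (balancedMap M g) := by
  have hex : Function.Exact (intTensorMap M f) (intTensorMap M g) :=
    lTensor_exact M (f := f.toAddMonoidHom.toIntLinearMap)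
      (g := g.toAddMonoidHom.toIntLinearMap) hfg hg
  intro t
  constructor
  · obtain ⟨t, rfl⟩ := QuotientAddGroup.mk'_surjective _ t
    intro ht
    have hmem : intTensorMap M g t ∈ balancedRel R M C := (QuotientAddGroup.eq_zero_iff _).1 ht
    rw [← map_balancedRel M hg] at hmem
    obtain ⟨s, hs, hst⟩ := hmem
    obtain ⟨a, ha⟩ := (hex (t - s)).1 (by rw [map_sub, hst, sub_self])
    refine ⟨QuotientAddGroup.mk a, QuotientAddGroup.eq.2 ?_⟩
    rw [ha, neg_sub, sub_add_cancel]
    exact hs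
  · rintro ⟨s, rfl⟩
    obtain ⟨s, rfl⟩ := QuotientAddGroup.mk'_surjective _ s
    exact congrArg (QuotientAddGroup.mk' _) (hex.apply_apply_eq_zero s)

variable (M) in
/-- The evaluation `x ⊗ c ↦ x · c i` of `M ⊗_R (ι →₀ R)` at `i`. -/
noncomputable def balancedEval {ι : Type*} (i : ι) : BalancedTensor R M (ι →₀ R) →+ M :=
  balancedLift ((smulAddHom Rᵐᵒᵖ M).comp
    (opAddEquiv.toAddMonoidHom.comp (Finsupp.applyAddHom i))).flip
    fun x r c => (mul_smul (op (c i)) (op r) x).symm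

@[simp]
theorem balancedEval_tmul {ι : Type*} (i : ι) (x : M) (c : ι →₀ R) :
    balancedEval M i (balancedTmul R x c) = op (c i) • x :=
  rfl

/-- The equational criterion for the vanishing of a tensor, the analogue over a noncommutative
ring of `TensorProduct.vanishesTrivially_iff_sum_tmul_eq_zero`. -/
theorem sum_balancedTmul_eq_zero_iff {ι : Type*} [Fintype ι] (x : ι → M) (b : ι → B) :
    ∑ i, balancedTmul R (x i) (b i) = 0 ↔
      ∃ (m p : ℕ) (y : Fin m → M) (c : Fin p → B) (r : ι ⊕ Fin m → Fin p → R),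
        (∀ i, Sum.elim b 0 i = ∑ j, r i j • c j) ∧ ∀ j, ∑ i, op (r i j) • Sum.elim x y i = 0 := by
  constructor
  · intro h
    let π : (B →₀ R) →ₗ[R] B := Finsupp.linearCombination R id
    have hπ : Function.Surjective π := fun b => ⟨Finsupp.single b 1, by simp [π]⟩
    have hex := balancedMap_exact (M := M) (A := LinearMap.ker π)
      (LinearMap.exact_subtype_ker_map π) hπ
    obtain ⟨s, hs⟩ := (hex (∑ i, balancedTmul R (x i) (Finsupp.single (b i) 1))).1
      (by simpa [π] using h)
    obtain ⟨m, y, k, rfl⟩ := exists_sum_balancedTmul s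
    let g : ι ⊕ Fin m → B →₀ R := Sum.elim (fun i => Finsupp.single (b i) 1) fun l => k l
    have hg (i) : Sum.elim b 0 i = π (g i) := by
      rcases i with i | l
      · simp [g, π]
      · exact (k l).2.symm
    have hev (c : B) : ∑ i, op (g i c) • Sum.elim x (-y) i = 0 := by
      have := congrArg (balancedEval M c) hs
      simp only [map_sum, balancedMap_tmul, balancedEval_tmul, Submodule.subtype_apply] at this
      simp [g, this]
    classical
    let S : Finset B := Finset.univ.biUnion fun i => (g i).support
    refine ⟨m, S.card, -y, fun j => (S.equivFin.symm j).1, fun i j => g i (S.equivFin.symm j),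
      fun i => ?_, fun j => hev _⟩
    rw [hg, S.equivFin.symm.sum_comp fun c : S => g i c • c.1, S.sum_coe_sort fun c => g i c • c]
    exact Finsupp.sum_of_support_subset _
      (Finset.subset_biUnion_of_mem (fun i => (g i).support) (Finset.mem_univ i)) _
        fun _ _ => zero_smul R _
  · rintro ⟨m, p, y, c, r, hb, hx⟩
    calc ∑ i, balancedTmul R (x i) (b i)
        = ∑ i, balancedTmul R (Sum.elim x y i) (Sum.elim b 0 i) := by
          simp
      _ = ∑ j, balancedTmul R (∑ i, op (r i j) • Sum.elim x y i) (c j) := by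
          simp only [hb, map_sum, balancedTmul_smul, AddMonoidHom.finsetSum_apply]
          exact Finset.sum_comm
      _ = 0 := by simp only [hx, map_zero, AddMonoidHom.zero_apply, Finset.sum_const_zero]

end BalancedTensor

/-! ### Purity and systems of linear equations -/

section Modules

open MulOpposite

variable {R : Type v} [Ring R] {A B C : Type*} [AddCommGroup A] [Module R A]
  [AddCommGroup B] [Module R B] [AddCommGroup C] [Module R C]

/-- Every finite system of linear equations with constants in `A` that is solvable in `B` is
solvable in `A`: the elementwise form of purity of `f : A → B`. -/
def IsSystemPure (f : A →ₗ[R] B) : Prop :=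
  ∀ ⦃ι κ : Type⦄ [Fintype ι] [Fintype κ] (r : ι → κ → R) (a : ι → A) (b : κ → B),
    (∀ i, f (a i) = ∑ j, r i j • b j) → ∃ a' : κ → A, ∀ i, a i = ∑ j, r i j • a' j

theorem IsSystemPure.injective_balancedMap {f : A →ₗ[R] B} (hf : IsSystemPure f)
    (M : Type*) [AddCommGroup M] [Module Rᵐᵒᵖ M] :
    Function.Injective (balancedMap M f) := by
  rw [injective_iff_map_eq_zero]
  intro t ht
  obtain ⟨n, x, a, rfl⟩ := exists_sum_balancedTmul t
  simp only [map_sum, balancedMap_tmul] at ht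
  obtain ⟨m, p, y, b, r, hb, hx⟩ := (sum_balancedTmul_eq_zero_iff x fun i => f (a i)).1 ht
  obtain ⟨a', ha'⟩ := hf r (Sum.elim a 0) b fun i => by
    rw [← hb]
    rcases i with i | _
    · rfl
    · exact map_zero f
  exact (sum_balancedTmul_eq_zero_iff x a).2 ⟨m, p, y, a', r, ha', hx⟩

section

variable {ι κ : Type*} (r : ι → κ → R)

/-- The right `R`-module with a generator for every equation and a relation for every unknown of
the linear system with coefficients `r`, lifted to a larger universe. -/
def EquationModule : Type _ :=
  ULift.{u} ((ι → R) ⧸ Submodule.span Rᵐᵒᵖ (Set.range fun j i => r i j))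

namespace EquationModule

instance : AddCommGroup (EquationModule.{u} r) :=
  inferInstanceAs (AddCommGroup (ULift.{u} (_ ⧸ _)))

instance : Module Rᵐᵒᵖ (EquationModule.{u} r) :=
  inferInstanceAs (Module Rᵐᵒᵖ (ULift.{u} (_ ⧸ _)))

/-- The presentation of `EquationModule r`. -/
def proj : (ι → R) →ₗ[Rᵐᵒᵖ] EquationModule.{u} r :=
  ULift.moduleEquiv.symm.toLinearMap ∘ₗ Submodule.mkQ _

theorem proj_surjective : Function.Surjective (proj.{u} r) :=
  ULift.moduleEquiv.symm.surjective.comp (Submodule.mkQ_surjective _)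

theorem proj_eq_zero_iff [Fintype κ] (v : ι → R) :
    proj.{u} r v = 0 ↔ ∃ t : κ → R, ∀ i, v i = ∑ j, r i j * t j := by
  have hproj : proj.{u} r v = 0 ↔
      v ∈ Submodule.span Rᵐᵒᵖ (Set.range fun (j : κ) (i : ι) => r i j) :=
    (ULift.moduleEquiv.symm.map_eq_zero_iff).trans (Submodule.Quotient.mk_eq_zero _)
  rw [hproj, Submodule.mem_span_range_iff_exists_fun, (Equiv.refl κ).arrowCongr opEquiv.symm
    |>.exists_congr_left]
  simp [funext_iff, eq_comm, Finset.sum_apply]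

theorem proj_column (j : κ) : proj.{u} r (fun i => r i j) = 0 :=
  (ULift.moduleEquiv.symm.map_eq_zero_iff).2
    ((Submodule.Quotient.mk_eq_zero _).2 (Submodule.subset_span (Set.mem_range_self j)))

variable [Fintype ι] [DecidableEq ι]

theorem sum_smul_proj_single (v : ι → R) :
    ∑ i, op (v i) • proj.{u} r (Pi.single i 1) = proj r v := by
  simp only [← map_smul, ← map_sum]
  congr 1
  ext i
  simp [Finset.sum_apply, Pi.single_apply]

theorem sum_balancedTmul_eq_zero_iff [Fintype κ] (a : ι → A) :
    ∑ i, balancedTmul R (proj.{u} r (Pi.single i 1)) (a i) = 0 ↔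
      ∃ a' : κ → A, ∀ i, a i = ∑ j, r i j • a' j := by
  constructor
  · intro h
    obtain ⟨m, p, y, c, k, hk, hky⟩ := (PureComplex.sum_balancedTmul_eq_zero_iff _ a).1 h
    choose v hv using fun l => proj_surjective r (y l)
    have hw (j : Fin p) :
        proj.{u} r (fun i => k (.inl i) j + ∑ l, v l i * k (.inr l) j) = 0 := by
      rw [← hky j, Fintype.sum_sum_type]
      simp only [Sum.elim_inl, Sum.elim_inr, sum_smul_proj_single]
      simp only [← hv, ← map_smul, ← map_sum, ← map_add]
      congr 1
      ext i
      simp [Finset.sum_apply]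
    choose t ht using fun j => (proj_eq_zero_iff r _).1 (hw j)
    have hc (l) : ∑ j, k (.inr l) j • c j = 0 := (hk (.inr l)).symm
    refine ⟨fun s => ∑ j, t j s • c j, fun i => ?_⟩
    calc a i = ∑ j, k (.inl i) j • c j + ∑ l, v l i • ∑ j, k (.inr l) j • c j := by
          simp only [hc, smul_zero, Finset.sum_const_zero, add_zero]
          exact hk (.inl i)
      _ = ∑ j, (k (.inl i) j + ∑ l, v l i * k (.inr l) j) • c j := by
          simp only [Finset.smul_sum, add_smul, Finset.sum_add_distrib, Finset.sum_smul, mul_smul]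
          rw [Finset.sum_comm]
      _ = ∑ s, r i s • ∑ j, t j s • c j := by
          simp only [ht, Finset.smul_sum, Finset.sum_smul, mul_smul]
          exact Finset.sum_comm
  · rintro ⟨a', ha'⟩
    calc ∑ i, balancedTmul R (proj.{u} r (Pi.single i 1)) (a i)
        = ∑ j, balancedTmul R (∑ i, op (r i j) • proj.{u} r (Pi.single i 1)) (a' j) := by
          simp only [ha', map_sum, balancedTmul_smul, AddMonoidHom.finsetSum_apply]
          exact Finset.sum_comm
      _ = 0 := by
          simp only [sum_smul_proj_single, proj_column, map_zero, AddMonoidHom.zero_apply,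
            Finset.sum_const_zero]

end EquationModule

end

theorem isSystemPure_of_injective_balancedMap {f : A →ₗ[R] B}
    (hf : ∀ (M : Type (max u v)) [AddCommGroup M] [Module Rᵐᵒᵖ M],
      Function.Injective (balancedMap M f)) :
    IsSystemPure f := by
  classical
  intro ι κ _ _ r a b hab
  rw [← EquationModule.sum_balancedTmul_eq_zero_iff.{u}]
  refine (injective_iff_map_eq_zero _).1 (hf _) _ ?_
  simp only [map_sum, balancedMap_tmul]
  exact (EquationModule.sum_balancedTmul_eq_zero_iff r _).2 ⟨b, hab⟩

section Presentation

theorem finitePresentation_quotient_span {ι κ : Type*} [Finite ι] [Finite κ] (r : ι → κ → R) :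
    Module.FinitePresentation R ((κ → R) ⧸ Submodule.span R (Set.range r)) :=
  Module.finitePresentation_of_surjective _ (Submodule.mkQ_surjective _) (by
    rw [Submodule.ker_mkQ]
    exact Submodule.fg_span (Set.finite_range r))

theorem exists_linearEquiv_quotient_span (F : Type*) [AddCommGroup F] [Module R F]
    [Module.FinitePresentation R F] :
    ∃ (m n : ℕ) (r : Fin m → Fin n → R),
      Nonempty (F ≃ₗ[R] (Fin n → R) ⧸ Submodule.span R (Set.range r)) := by
  obtain ⟨n, K, e, hK⟩ := Module.FinitePresentation.exists_fin R F
  obtain ⟨m, r, rfl⟩ := Submodule.fg_iff_exists_fin_generating_family.1 hK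
  exact ⟨m, n, r, ⟨e⟩⟩

theorem exists_quotient_span_hom_iff {ι κ : Type*} [Fintype κ] [DecidableEq κ] (r : ι → κ → R)
    (c : κ → C) :
    (∃ h : (κ → R) ⧸ Submodule.span R (Set.range r) →ₗ[R] C,
      ∀ j, h (Submodule.Quotient.mk (Pi.single j 1)) = c j) ↔ ∀ i, ∑ j, r i j • c j = 0 := by
  constructor
  · rintro ⟨h, hh⟩ i
    have hi : (∑ j, r i j • Pi.single j 1 : κ → R) = r i := by
      ext j
      simp [Finset.sum_apply, Pi.single_apply]
    simp only [← hh, ← map_smul, ← map_sum, ← Submodule.mkQ_apply, hi]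
    rw [Submodule.mkQ_apply, (Submodule.Quotient.mk_eq_zero _).2
      (Submodule.subset_span (Set.mem_range_self i)), map_zero]
  · intro hc
    refine ⟨Submodule.liftQ _ (Fintype.linearCombination R c) ?_, fun j => ?_⟩
    · rw [Submodule.span_le]
      rintro _ ⟨i, rfl⟩
      exact hc i
    · simp [Fintype.linearCombination_apply_single]

theorem quotient_span_hom_ext {ι κ : Type*} [Finite κ] [DecidableEq κ] {r : ι → κ → R}
    {h h' : (κ → R) ⧸ Submodule.span R (Set.range r) →ₗ[R] C}
    (hh : ∀ j, h (Submodule.Quotient.mk (Pi.single j 1)) =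
      h' (Submodule.Quotient.mk (Pi.single j 1))) : h = h' :=
  Submodule.linearMap_qext _ (LinearMap.pi_ext' fun j => LinearMap.ext_ring (hh j))

end Presentation

/-- Every map from a finitely presented module to `C` lifts along `g : B → C`. -/
def IsFPSurjective (g : B →ₗ[R] C) : Prop :=
  ∀ (F : Type v) [AddCommGroup F] [Module R F] [Module.FinitePresentation R F]
    (h : F →ₗ[R] C), ∃ l : F →ₗ[R] B, g ∘ₗ l = h

theorem IsFPSurjective.surjective {g : B →ₗ[R] C} (hg : IsFPSurjective g) :
    Function.Surjective g := by
  intro c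
  obtain ⟨l, hl⟩ := hg R (LinearMap.toSpanSingleton R C c)
  exact ⟨l 1, by simpa using LinearMap.congr_fun hl 1⟩

theorem IsFPSurjective.exists_solution {g : B →ₗ[R] C} (hg : IsFPSurjective g) {ι κ : Type}
    [Finite ι] [Fintype κ] (r : ι → κ → R) (c : κ → C) (hc : ∀ i, ∑ j, r i j • c j = 0) :
    ∃ b : κ → B, (∀ j, g (b j) = c j) ∧ ∀ i, ∑ j, r i j • b j = 0 := by
  classical
  have := finitePresentation_quotient_span r
  obtain ⟨h, hh⟩ := (exists_quotient_span_hom_iff r c).2 hc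
  obtain ⟨l, rfl⟩ := hg _ h
  exact ⟨_, hh, (exists_quotient_span_hom_iff r _).1 ⟨l, fun _ => rfl⟩⟩

variable {f : A →ₗ[R] B} {g : B →ₗ[R] C}

theorem IsSystemPure.isFPSurjective (hf : IsSystemPure f) (hfg : Function.Exact f g)
    (hg : Function.Surjective g) : IsFPSurjective g := by
  intro F _ _ _ h
  obtain ⟨m, n, r, ⟨e⟩⟩ := exists_linearEquiv_quotient_span (R := R) F
  let c (j : Fin n) : C := h (e.symm (Submodule.Quotient.mk (Pi.single j 1)))
  have hc : ∀ i, ∑ j, r i j • c j = 0 :=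
    (exists_quotient_span_hom_iff r c).1 ⟨h ∘ₗ e.symm.toLinearMap, fun _ => rfl⟩
  choose b hb using fun j => hg (c j)
  choose a ha using fun i => (hfg (∑ j, r i j • b j)).1 (by simpa [hb] using hc i)
  obtain ⟨a', ha'⟩ := hf r a b ha
  obtain ⟨l, hl⟩ := (exists_quotient_span_hom_iff r fun j => b j - f (a' j)).2 fun i => by
    simp [smul_sub, ← ha, ha' i]
  refine ⟨l ∘ₗ e.toLinearMap, ?_⟩
  have hgl : g ∘ₗ l = h ∘ₗ e.symm.toLinearMap := quotient_span_hom_ext fun j => by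
    simp [hl, hb, hfg.apply_apply_eq_zero, c]
  rw [← LinearMap.comp_assoc, hgl, LinearMap.comp_assoc]
  simp

theorem IsFPSurjective.isSystemPure (hg : IsFPSurjective g) (hf : Function.Injective f)
    (hfg : Function.Exact f g) : IsSystemPure f := by
  intro ι κ _ _ r a b hab
  obtain ⟨b', hb', hrb'⟩ := hg.exists_solution r (fun j => g (b j)) fun i => by
    simp only [← map_smul, ← map_sum, ← hab, hfg.apply_apply_eq_zero]
  choose a' ha' using fun j => (hfg (b j - b' j)).1 (by rw [map_sub, hb', sub_self])
  refine ⟨a', fun i => hf ?_⟩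
  simp [ha', smul_sub, hab, hrb']

theorem isPureShortExact_iff {S : ShortComplex (ModuleCat.{u} R)} (hS : S.ShortExact) :
    IsPureShortExact S ↔ IsFPSurjective S.g.hom := by
  have hfg : Function.Exact S.f.hom S.g.hom :=
    (ShortComplex.ShortExact.moduleCat_exact_iff_function_exact S).1 hS.exact
  have hg : Function.Surjective S.g.hom := hS.moduleCat_surjective_g
  constructor
  · intro h
    exact (isSystemPure_of_injective_balancedMap fun M _ _ => (h.2 M).1).isFPSurjective hfg hg
  · intro h
    have hf := h.isSystemPure hS.moduleCat_injective_f hfg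
    exact ⟨hS, fun M _ _ =>
      ⟨hf.injective_balancedMap M, balancedMap_exact hfg hg, balancedMap_surjective hg⟩⟩

theorem isPureEpic_iff {B C : ModuleCat.{u} R} {g : B ⟶ C} :
    IsPureEpic g ↔ IsFPSurjective g.hom := by
  constructor
  · rintro ⟨A, f, w, h⟩
    exact (isPureShortExact_iff h.1).1 h
  · intro h
    have : Epi g := (ModuleCat.epi_iff_surjective g).2 h.surjective
    have hS : (ShortComplex.mk (kernel.ι g) g (kernel.condition g)).ShortExact :=
      { exact := ShortComplex.exact_kernel g }
    exact ⟨_, _, _, (isPureShortExact_iff hS).2 h⟩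

end Modules

/-! ### Pure exactness of complexes -/

section Complexes

variable {R : Type v} [Ring R]

theorem IsPureMonic.mono {A B : ModuleCat.{u} R} {f : A ⟶ B} (h : IsPureMonic f) : Mono f := by
  obtain ⟨_, _, _, h⟩ := h
  exact h.1.mono_f

/-- Every map from a finitely presented module to the cycles of `X` lifts along the differential:
the elementwise form of pure exactness. -/
def IsFPAcyclic (X : CochainComplex (ModuleCat.{u} R) ℤ) : Prop :=
  ∀ ⦃i j k : ℤ⦄, i + 1 = j → j + 1 = k →
    ∀ (F : Type v) [AddCommGroup F] [Module R F] [Module.FinitePresentation R F]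
      (z : F →ₗ[R] X.X j), (X.d j k).hom ∘ₗ z = 0 → ∃ w : F →ₗ[R] X.X i, (X.d i j).hom ∘ₗ w = z

variable {X : CochainComplex (ModuleCat.{u} R) ℤ}

theorem Decomposes.exists_d_comp_eq {i j k : ℤ} (h : Decomposes (X.d i j))
    (hex : Function.Exact (X.d i j) (X.d j k)) {F : Type v} [AddCommGroup F] [Module R F]
    [Module.FinitePresentation R F] (z : F →ₗ[R] X.X j) (hz : (X.d j k).hom ∘ₗ z = 0) :
    ∃ w : F →ₗ[R] X.X i, (X.d i j).hom ∘ₗ w = z := by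
  obtain ⟨D, p, m, hp, hm, hpm⟩ := h
  have hinj : Function.Injective m.hom := (ModuleCat.mono_iff_injective m).1 hm.mono
  have hrange (x : F) : z x ∈ LinearMap.range m.hom := by
    obtain ⟨y, hy⟩ := (hex _).1 (LinearMap.congr_fun hz x)
    exact ⟨p y, by rw [← hy, ← hpm]; rfl⟩
  obtain ⟨w, hw⟩ := isPureEpic_iff.1 hp F
    ((LinearEquiv.ofInjective m.hom hinj).symm.toLinearMap ∘ₗ z.codRestrict _ hrange)
  refine ⟨w, ?_⟩
  rw [← hpm, ModuleCat.hom_comp, LinearMap.comp_assoc, hw]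
  ext x
  exact congrArg Subtype.val
    ((LinearEquiv.ofInjective m.hom hinj).apply_symm_apply (z.codRestrict _ hrange x))

theorem IsPureExact.isFPAcyclic (hX : IsPureExact X) : IsFPAcyclic X := by
  rintro i j k hij rfl F _ _ _ z hz
  obtain rfl : i = j - 1 := by lia
  obtain ⟨hdec, -, w, -⟩ := hX j
  have hex : (ShortComplex.mk _ _ (X.d_comp_d (j - 1) j (j + 1))).Exact :=
    (ShortComplex.exact_iff_kernel_ι_comp_cokernel_π_zero _).2 w
  exact hdec.exists_d_comp_eq
    ((ShortComplex.ShortExact.moduleCat_exact_iff_function_exact _).1 hex) z hz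

namespace IsFPAcyclic

theorem exact (hX : IsFPAcyclic X) {i j k : ℤ} (hij : i + 1 = j) (hjk : j + 1 = k) :
    (ShortComplex.mk _ _ (X.d_comp_d i j k)).Exact := by
  refine (ShortComplex.ShortExact.moduleCat_exact_iff_function_exact _).2 fun x =>
    ⟨fun hx => ?_, ?_⟩
  · obtain ⟨w, hw⟩ := hX hij hjk R (LinearMap.toSpanSingleton R _ x) (by ext; simpa using hx)
    exact ⟨w 1, by simpa using LinearMap.congr_fun hw 1⟩
  · rintro ⟨y, rfl⟩
    exact ConcreteCategory.congr_hom (X.d_comp_d i j k) y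

theorem isPureEpic_of_epi_mono (hX : IsFPAcyclic X) {i j : ℤ} (hij : i + 1 = j)
    {D : ModuleCat.{u} R} {p : X.X i ⟶ D} {m : D ⟶ X.X j} [Epi p] [Mono m] (h : p ≫ m = X.d i j) :
    IsPureEpic p := by
  refine isPureEpic_iff.2 fun F _ _ _ z => ?_
  have hm : m ≫ X.d j (j + 1) = 0 := by
    rw [← cancel_epi p, ← Category.assoc, h, X.d_comp_d, comp_zero]
  obtain ⟨w, hw⟩ := hX hij rfl F (m.hom ∘ₗ z) (by
    rw [← LinearMap.comp_assoc, ← ModuleCat.hom_comp, hm, ModuleCat.hom_zero, LinearMap.zero_comp])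
  refine ⟨w, ?_⟩
  rw [← h, ModuleCat.hom_comp, LinearMap.comp_assoc] at hw
  exact LinearMap.cancel_left ((ModuleCat.mono_iff_injective m).1 inferInstance) |>.1 hw

theorem isPureShortExact (hX : IsFPAcyclic X) {i j k : ℤ} (hij : i + 1 = j) (hjk : j + 1 = k)
    (w : kernel.ι (X.d j k) ≫ cokernel.π (X.d i j) = 0) :
    IsPureShortExact (ShortComplex.mk _ _ w) := by
  have hdesc : Mono (cokernel.desc (X.d i j) (X.d j k) (X.d_comp_d i j k)) :=
    (hX.exact hij hjk).mono_cokernelDesc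
  let φ : ShortComplex.mk _ _ w ⟶ ShortComplex.mk _ _ (kernel.condition (X.d j k)) :=
    { τ₁ := 𝟙 _
      τ₂ := 𝟙 _
      τ₃ := cokernel.desc (X.d i j) (X.d j k) (X.d_comp_d i j k) }
  have hS : (ShortComplex.mk _ _ w).ShortExact :=
    { exact := (ShortComplex.exact_iff_of_epi_of_isIso_of_mono φ).2 (ShortComplex.exact_kernel _) }
  exact (isPureShortExact_iff hS).2
    (isPureEpic_iff.1 (hX.isPureEpic_of_epi_mono hjk (cokernel.π_desc _ _ _)))

theorem decomposes (hX : IsFPAcyclic X) {i j : ℤ} (hij : i + 1 = j) : Decomposes (X.d i j) := by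
  have hex := hX.exact hij rfl
  have : Epi (kernel.lift (X.d j (j + 1)) (X.d i j) (X.d_comp_d _ _ _)) := hex.epi_kernelLift
  exact ⟨_, _, _, hX.isPureEpic_of_epi_mono hij (kernel.lift_ι _ _ (X.d_comp_d _ _ _)),
    ⟨_, _, _, hX.isPureShortExact hij rfl
      ((ShortComplex.exact_iff_kernel_ι_comp_cokernel_π_zero _).1 hex)⟩, kernel.lift_ι _ _ _⟩

theorem isPureExact (hX : IsFPAcyclic X) : IsPureExact X := fun n =>
  ⟨hX.decomposes (sub_add_cancel n 1), hX.decomposes rfl,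
    (ShortComplex.exact_iff_kernel_ι_comp_cokernel_π_zero _).1
      (hX.exact (sub_add_cancel n 1) rfl), hX.isPureShortExact (sub_add_cancel n 1) rfl _⟩

end IsFPAcyclic

theorem isPureExact_iff : IsPureExact X ↔ IsFPAcyclic X :=
  ⟨IsPureExact.isFPAcyclic, IsFPAcyclic.isPureExact⟩

end Complexes

/-! ### Lifting against spheres in disks -/

section SmallObjectArgument

open MorphismProperty

theorem hasSmallObjectArgument_ofHoms {C : Type u} [Category.{v} C] [Abelian C]
    [IsGrothendieckAbelian.{w} C] {T : Type w} {A B : T → C} (f : ∀ t, A t ⟶ B t)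
    [∀ t, Mono (f t)] : HasSmallObjectArgument.{w} (ofHoms f) := by
  -- Beyond the number of subobjects of each `A t`, maps out of `A t` factor through a stage.
  obtain ⟨κ, hκ', hκ⟩ := HasCardinalLT.exists_regular_cardinal.{w} (Σ t, Subobject (A t))
  have : Fact κ.IsRegular := ⟨hκ'⟩
  have : Nonempty κ.ord.ToType := by simpa using hκ'.ne_zero
  have := WellFoundedLT.toOrderBot κ.ord.ToType
  have hmono : ofHoms f ≤ monomorphisms C := by
    rintro _ _ _ ⟨t⟩
    exact monomorphisms.infer_property _
  refine ⟨κ, inferInstance, inferInstance, { preservesColimit := ?_ }⟩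
  rintro _ _ X Y _ ⟨t⟩ g hg
  have hmem (j : κ.ord.ToType) (hj : ¬ IsMax j) := (hg.attachCells j hj).pushouts_coproducts
  simp only [ofHoms_homFamily] at hmem
  let hg' : (monomorphisms C).TransfiniteCompositionOfShape κ.ord.ToType g :=
    { hg.toTransfiniteCompositionOfShape with
      map_mem j hj := by
        refine (?_ : _ ≤ monomorphisms C) _ (hmem j hj)
        simpa only [pushouts_le_iff, coproducts_le_iff] using hmono }
  have (j j' : κ.ord.ToType) (φ : j ⟶ j') : Mono (hg'.F.map φ) := hg'.mem_map φ
  refine IsGrothendieckAbelian.preservesColimit_coyoneda_obj_of_mono (Y := hg'.F) (κ := κ) ?_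
  exact hκ.of_injective (fun S => (⟨t, S⟩ : Σ t, Subobject (A t)))
    (sigma_mk_injective (β := fun t => Subobject (A t)))

end SmallObjectArgument

section Lifting

open MorphismProperty HomologicalComplex
open scoped ZeroObject

section SphereToDisk

variable {C : Type*} [Category* C] [Preadditive C] [HasZeroObject C]

/-- The inclusion of the complex `F` concentrated in degree `n + 1` into the complex `F = F`
concentrated in degrees `n` and `n + 1`. -/
noncomputable def sphereToDisk (n : ℤ) (F : C) :
    (single C (ComplexShape.up ℤ) (n + 1)).obj F ⟶
      double (𝟙 F) (show (ComplexShape.up ℤ).Rel n (n + 1) from rfl) :=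
  mkHomFromSingle (doubleXIso₁ _ _ (by simp)).inv
    fun _ _ => by rw [double_d_eq_zero₀ _ _ _ _ (by simp), comp_zero]

theorem sphereToDisk_f (n : ℤ) (F : C) :
    (sphereToDisk n F).f (n + 1) =
      (singleObjXSelf _ (n + 1) F).hom ≫ (doubleXIso₁ _ _ (by simp)).inv :=
  mkHomFromSingle_f _ _

instance mono_sphereToDisk (n : ℤ) (F : C) : Mono (sphereToDisk n F) := by
  refine mono_of_mono_f _ fun i => ?_
  by_cases hi : i = n + 1
  · subst hi
    rw [sphereToDisk_f]
    infer_instance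
  · exact ⟨fun _ _ _ => (isZero_single_obj_X _ _ _ _ hi).eq_of_tgt _ _⟩

theorem hasLiftingProperty_sphereToDisk_iff {n : ℤ} {F : C} {E B : CochainComplex C ℤ}
    (p : E ⟶ B) : HasLiftingProperty (sphereToDisk n F) p ↔
      ∀ (x : F ⟶ E.X (n + 1)) (y : F ⟶ B.X n), x ≫ E.d (n + 1) (n + 1 + 1) = 0 →
        y ≫ B.d n (n + 1) = x ≫ p.f (n + 1) →
        ∃ z : F ⟶ E.X n, z ≫ E.d n (n + 1) = x ∧ z ≫ p.f n = y := by
  constructor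
  · intro h x y hx hxy
    let x' : (single C (ComplexShape.up ℤ) (n + 1)).obj F ⟶ E :=
      mkHomFromSingle x (by rintro _ rfl; exact hx)
    let y' : double (𝟙 F) (show (ComplexShape.up ℤ).Rel n (n + 1) from rfl) ⟶ B :=
      mkHomFromDouble _ (by simp) y (y ≫ B.d n (n + 1)) (Category.id_comp _).symm (by simp)
    have sq : CommSq x' (sphereToDisk n F) p y' :=
      ⟨from_single_hom_ext (by simp [x', y', sphereToDisk_f, hxy])⟩
    refine ⟨(doubleXIso₀ _ _).inv ≫ sq.lift.f n, ?_, ?_⟩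
    · have := congr_hom sq.fac_left (n + 1)
      rw [comp_f, sphereToDisk_f, mkHomFromSingle_f, Category.assoc, cancel_epi] at this
      rw [Category.assoc, sq.lift.comm, double_d _ _ (by simp)]
      simpa using this
    · have := congr_hom sq.fac_right n
      simp [← comp_f, y']
  · intro h
    refine ⟨fun {x y} sq => ?_⟩
    have hn : n ≠ n + 1 := by simp
    obtain ⟨z, hz, hz'⟩ := h ((singleObjXSelf _ _ F).inv ≫ x.f (n + 1))
      ((doubleXIso₀ _ _).inv ≫ y.f n) (by simp) (by
        have := congr_hom sq.w (n + 1)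
        rw [comp_f, comp_f, sphereToDisk_f] at this
        simp [this, double_d _ _ hn])
    refine ⟨⟨⟨mkHomFromDouble _ hn z (z ≫ E.d n (n + 1)) (by simp) (by simp), ?_, ?_⟩⟩⟩
    · exact from_single_hom_ext (by simp [sphereToDisk_f, hz])
    · refine from_double_hom_ext (by simp [hz']) ?_
      have := congr_hom sq.w (n + 1)
      rw [comp_f, comp_f, sphereToDisk_f] at this
      simp [hz, this]

end SphereToDisk

section Cofibrant

variable {R : Type v} [Ring R]

/-- The trivial fibrations of the pure homotopy theory of complexes: the maps with the right
lifting property against the inclusions `sphereToDisk n F` with `F` finitely presented. -/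
def IsFPTrivialFibration {E B : CochainComplex (ModuleCat.{u} R) ℤ} (p : E ⟶ B) : Prop :=
  ∀ ⦃i j k : ℤ⦄, i + 1 = j → j + 1 = k →
    ∀ (F : Type v) [AddCommGroup F] [Module R F] [Module.FinitePresentation R F]
      (x : F →ₗ[R] E.X j) (y : F →ₗ[R] B.X i), (E.d j k).hom ∘ₗ x = 0 →
        (B.d i j).hom ∘ₗ y = (p.f j).hom ∘ₗ x →
        ∃ z : F →ₗ[R] E.X i, (E.d i j).hom ∘ₗ z = x ∧ (p.f i).hom ∘ₗ z = y

/-- A complex is cofibrant if maps out of it lift along the trivial fibrations. -/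
def IsCofibrant (P : CochainComplex (ModuleCat.{u} R) ℤ) : Prop :=
  ∀ ⦃E B : CochainComplex (ModuleCat.{u} R) ℤ⦄ (p : E ⟶ B), IsFPTrivialFibration p →
    ∀ g : P ⟶ B, ∃ l : P ⟶ E, l ≫ p = g

end Cofibrant

section Factorization

variable (R : Type u) [Ring R]

/-- One representative `sphereToDisk n F` for each `n` and each finitely presented module `F`. -/
def generatingCofibrations : MorphismProperty (CochainComplex (ModuleCat.{u} R) ℤ) :=
  ofHoms fun t : ℤ × Σ m n : ℕ, Fin m → Fin n → R =>
    sphereToDisk t.1 (ModuleCat.of R ((Fin t.2.2.1 → R) ⧸ Submodule.span R (Set.range t.2.2.2)))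

instance : HasSmallObjectArgument.{u} (generatingCofibrations R) :=
  hasSmallObjectArgument_ofHoms _

variable {R}

theorem rlp_generatingCofibrations_iff {E B : CochainComplex (ModuleCat.{u} R) ℤ} (p : E ⟶ B) :
    (generatingCofibrations R).rlp p ↔ IsFPTrivialFibration p := by
  constructor
  · rintro hp i _ _ rfl rfl F _ _ _ x y hx hxy
    obtain ⟨m, n, r, ⟨e⟩⟩ := exists_linearEquiv_quotient_span (R := R) F
    obtain ⟨z, hz, hz'⟩ := (hasLiftingProperty_sphereToDisk_iff p).1
      (hp _ (ofHoms.mk (i := (⟨i, m, n, r⟩ : ℤ × Σ m n : ℕ, Fin m → Fin n → R))))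
      (ModuleCat.ofHom (x ∘ₗ e.symm.toLinearMap)) (ModuleCat.ofHom (y ∘ₗ e.symm.toLinearMap))
      (ModuleCat.hom_ext (LinearMap.ext fun q => LinearMap.congr_fun hx (e.symm q)))
      (ModuleCat.hom_ext (LinearMap.ext fun q => LinearMap.congr_fun hxy (e.symm q)))
    refine ⟨z.hom ∘ₗ e.toLinearMap, LinearMap.ext fun q => ?_, LinearMap.ext fun q => ?_⟩
    · simpa using ConcreteCategory.congr_hom hz (e q)
    · simpa using ConcreteCategory.congr_hom hz' (e q)
  · rintro hp _ _ _ ⟨⟨n, r⟩⟩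
    have := finitePresentation_quotient_span r.2.2
    refine (hasLiftingProperty_sphereToDisk_iff p).2 fun x y hx hxy => ?_
    obtain ⟨z, hz, hz'⟩ := hp rfl rfl _ x.hom y.hom (congrArg ModuleCat.Hom.hom hx)
      (congrArg ModuleCat.Hom.hom hxy)
    exact ⟨ModuleCat.ofHom z, ModuleCat.hom_ext hz, ModuleCat.hom_ext hz'⟩

theorem exists_isCofibrant_isFPTrivialFibration (X : CochainComplex (ModuleCat.{u} R) ℤ) :
    ∃ (P : CochainComplex (ModuleCat.{u} R) ℤ) (f : P ⟶ X),
      IsCofibrant P ∧ IsFPTrivialFibration f := by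
  let D := (functorialFactorizationData (generatingCofibrations R).rlp.llp
    (generatingCofibrations R).rlp).factorizationData
      (0 : (0 : CochainComplex (ModuleCat.{u} R) ℤ) ⟶ X)
  refine ⟨D.Z, D.p, fun E B p hp g => ?_, (rlp_generatingCofibrations_iff _).1 D.hp⟩
  have : HasLiftingProperty D.i p := D.hi _ ((rlp_generatingCofibrations_iff p).2 hp)
  have sq : CommSq 0 D.i p g := ⟨(isZero_zero _).eq_of_src _ _⟩
  exact ⟨sq.lift, sq.fac_right⟩

end Factorization

end Lifting

/-! ### Cochains out of a cofibrant complex -/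

section Cochains

open HomologicalComplex CochainComplex CochainComplex.HomComplex

variable {R : Type v} [Ring R]

theorem isFPAcyclic_of_homotopy_id_zero {X : CochainComplex (ModuleCat.{u} R) ℤ}
    (h : Homotopy (𝟙 X) 0) : IsFPAcyclic X := by
  rintro i j _ hij rfl F _ _ _ z hz
  have hj : 𝟙 (X.X j) = X.d j (j + 1) ≫ h.hom (j + 1) j + h.hom j i ≫ X.d i j := by
    have := h.comm j
    rwa [dNext_eq _ (show (ComplexShape.up ℤ).Rel j (j + 1) from rfl),
      prevD_eq _ (show (ComplexShape.up ℤ).Rel i j from hij), zero_f, add_zero, id_f] at this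
  refine ⟨(h.hom j i).hom ∘ₗ z, LinearMap.ext fun x => ?_⟩
  have hx := ConcreteCategory.congr_hom hj (z x)
  have hzx : X.d j (j + 1) (z x) = 0 := LinearMap.congr_fun hz x
  simpa [hzx] using hx.symm

theorem IsFPAcyclic.shift {X : CochainComplex (ModuleCat.{u} R) ℤ} (hX : IsFPAcyclic X) (n : ℤ) :
    IsFPAcyclic (X⟦n⟧) := by
  intro i j k hij hjk F _ _ _ z hz
  obtain ⟨w, hw⟩ := hX (i := i + n) (j := j + n) (k := k + n) (by lia) (by lia) F z
    (LinearMap.ext fun x =>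
      (smul_eq_zero_iff_eq n.negOnePow).1 (LinearMap.congr_fun hz x))
  refine ⟨n.negOnePow • w, LinearMap.ext fun x => ?_⟩
  change n.negOnePow • X.d (i + n) (j + n) (n.negOnePow • w x) = z x
  rw [Units.smul_def, Units.smul_def, map_zsmul, ← Units.smul_def, ← Units.smul_def, smul_smul,
    Int.units_mul_self, one_smul]
  exact LinearMap.congr_fun hw x

namespace IsFPTrivialFibration

theorem isFPAcyclic_mappingCone {E B : CochainComplex (ModuleCat.{u} R) ℤ} {p : E ⟶ B}
    (hp : IsFPTrivialFibration p) : IsFPAcyclic (mappingCone p) := by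
  intro i j k hij hjk F _ _ _ z hz
  let fst := (mappingCone.fst p).1.v j k hjk
  let snd := (mappingCone.snd p).v j j (add_zero j)
  obtain ⟨w, hw, hw'⟩ := hp hjk rfl F (-(fst.hom ∘ₗ z)) (snd.hom ∘ₗ z)
    (LinearMap.ext fun x => by
      have := ConcreteCategory.congr_hom (mappingCone.d_fst_v p j k (k + 1) hjk rfl) (z x)
      have hzx : (mappingCone p).d j k (z x) = 0 := LinearMap.congr_fun hz x
      simpa [hzx, fst, eq_comm] using this)
    (LinearMap.ext fun x => by
      have := ConcreteCategory.congr_hom (mappingCone.d_snd_v p j k hjk) (z x)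
      have hzx : (mappingCone p).d j k (z x) = 0 := LinearMap.congr_fun hz x
      rw [ConcreteCategory.comp_apply, hzx, map_zero] at this
      change B.d j k (snd (z x)) = p.f k (-(fst (z x)))
      rw [map_neg]
      exact eq_neg_of_add_eq_zero_right this.symm)
  refine ⟨((mappingCone.inl p).v j i (by lia)).hom ∘ₗ w, LinearMap.ext fun x => ?_⟩
  have hd := ConcreteCategory.congr_hom (mappingCone.inl_v_d p j i k (by lia) (by lia)) (w x)
  have hid := ConcreteCategory.congr_hom (mappingCone.id_X p j k hjk) (z x)
  have hwx : E.d j k (w x) = -fst (z x) := LinearMap.congr_fun hw x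
  have hwx' : p.f j (w x) = snd (z x) := LinearMap.congr_fun hw' x
  change (mappingCone p).d i j ((mappingCone.inl p).v j i (by lia) (w x)) = z x
  simp_all [fst, snd, add_comm]

theorem of_isFPAcyclic {E B : CochainComplex (ModuleCat.{u} R) ℤ} {p : E ⟶ B}
    (hE : IsFPAcyclic E) (hB : IsFPAcyclic B) (hp : ∀ i, IsFPSurjective (p.f i).hom) :
    IsFPTrivialFibration p := by
  rintro i j k hij hjk F _ _ _ x y hx hxy
  have comm (a b : ℤ) : (B.d a b).hom ∘ₗ (p.f a).hom = (p.f b).hom ∘ₗ (E.d a b).hom :=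
    congrArg ModuleCat.Hom.hom (p.comm a b)
  obtain ⟨w, rfl⟩ := hE hij hjk F x hx
  obtain ⟨v, hv⟩ := hB (sub_add_cancel i 1) hij F (y - (p.f i).hom ∘ₗ w) (by
    rw [LinearMap.comp_sub, hxy, ← LinearMap.comp_assoc, ← LinearMap.comp_assoc, comm, sub_self])
  obtain ⟨u, rfl⟩ := hp (i - 1) F v
  refine ⟨w + (E.d (i - 1) i).hom ∘ₗ u, ?_, ?_⟩
  · rw [LinearMap.comp_add, ← LinearMap.comp_assoc, ← ModuleCat.hom_comp, E.d_comp_d,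
      ModuleCat.hom_zero, LinearMap.zero_comp, add_zero]
  · rw [LinearMap.comp_add, ← LinearMap.comp_assoc, ← comm, LinearMap.comp_assoc, hv,
      add_sub_cancel]

end IsFPTrivialFibration

/-- The contraction of the mapping cocone of an identity. -/
noncomputable def homotopyMappingCoconeIdZero (Y : CochainComplex (ModuleCat.{u} R) ℤ) :
    Homotopy (𝟙 (mappingCocone (𝟙 Y))) 0 :=
  (Homotopy.ofEq (CategoryTheory.Functor.map_id _ _).symm).trans
    (((mappingCone.homotopyToZeroOfId Y).shift (-1)).trans
      (Homotopy.ofEq (Functor.map_zero _ _ _)))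

theorem isFPTrivialFibration_mappingCocone_fst {Y : CochainComplex (ModuleCat.{u} R) ℤ}
    (hY : IsFPAcyclic Y) : IsFPTrivialFibration (mappingCocone.fst (𝟙 Y)) := by
  refine .of_isFPAcyclic (isFPAcyclic_of_homotopy_id_zero (homotopyMappingCoconeIdZero Y)) hY
    fun i F _ _ _ h => ⟨((mappingCocone.inl (𝟙 Y)).v i i (add_zero i)).hom ∘ₗ h, ?_⟩
  rw [← LinearMap.comp_assoc, ← ModuleCat.hom_comp, mappingCocone.inl_v_fst_f, ModuleCat.hom_id,
    LinearMap.id_comp]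

/-- The map between the (contractible) mapping cones of the identities of `K` and `L` induced by
`g : K ⟶ L`. -/
noncomputable def mappingConeIdMap {K L : CochainComplex (ModuleCat.{u} R) ℤ} (g : K ⟶ L) :
    mappingCone (𝟙 K) ⟶ mappingCone (𝟙 L) :=
  mappingCone.map (𝟙 K) (𝟙 L) g g (by simp)

section

variable {K L : CochainComplex (ModuleCat.{u} R) ℤ} (g : K ⟶ L)

theorem inl_v_mappingConeIdMap_f (i j : ℤ) (h : j + (-1) = i) :
    (mappingCone.inl (𝟙 K)).v j i h ≫ (mappingConeIdMap g).f i =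
      g.f j ≫ (mappingCone.inl (𝟙 L)).v j i h := by
  simp [mappingConeIdMap, mappingCone.map]

theorem inr_f_mappingConeIdMap_f (i : ℤ) :
    (mappingCone.inr (𝟙 K)).f i ≫ (mappingConeIdMap g).f i =
      g.f i ≫ (mappingCone.inr (𝟙 L)).f i := by
  simp [mappingConeIdMap, mappingCone.map]

theorem snd_comp_ofHom :
    (mappingCone.snd (𝟙 K)).comp (Cochain.ofHom g) (add_zero 0) =
      (Cochain.ofHom (mappingConeIdMap g)).comp (mappingCone.snd (𝟙 L)) (zero_add 0) := by
  refine Cochain.ext₀ _ _ fun i => mappingCone.ext_from (𝟙 K) (i + 1) i rfl ?_ ?_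
  · simp [mappingConeIdMap, mappingCone.map]
  · simp [mappingConeIdMap, mappingCone.map]

theorem isFPTrivialFibration_mappingConeIdMap {g : K ⟶ L}
    (hg : ∀ i, IsFPSurjective (g.f i).hom) : IsFPTrivialFibration (mappingConeIdMap g) := by
  refine .of_isFPAcyclic (isFPAcyclic_of_homotopy_id_zero (mappingCone.homotopyToZeroOfId K))
    (isFPAcyclic_of_homotopy_id_zero (mappingCone.homotopyToZeroOfId L)) fun i F _ _ _ h => ?_
  obtain ⟨a, ha⟩ := hg (i + 1) F (((mappingCone.fst (𝟙 L)).1.v i (i + 1) rfl).hom ∘ₗ h)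
  obtain ⟨b, hb⟩ := hg i F (((mappingCone.snd (𝟙 L)).v i i (add_zero i)).hom ∘ₗ h)
  refine ⟨((mappingCone.inl (𝟙 K)).v (i + 1) i (by lia)).hom ∘ₗ a +
    ((mappingCone.inr (𝟙 K)).f i).hom ∘ₗ b, LinearMap.ext fun x => ?_⟩
  have hinl := ConcreteCategory.congr_hom (inl_v_mappingConeIdMap_f g i (i + 1) (by lia)) (a x)
  have hinr := ConcreteCategory.congr_hom (inr_f_mappingConeIdMap_f g i) (b x)
  have hid := ConcreteCategory.congr_hom (mappingCone.id_X (𝟙 L) i (i + 1) rfl) (h x)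
  have hax : g.f (i + 1) (a x) = (mappingCone.fst (𝟙 L)).1.v i (i + 1) rfl (h x) :=
    LinearMap.congr_fun ha x
  have hbx : g.f i (b x) = (mappingCone.snd (𝟙 L)).v i i (add_zero i) (h x) :=
    LinearMap.congr_fun hb x
  simp_all

end

theorem isFPSurjective_single_map_f {B C : ModuleCat.{u} R} {p : B ⟶ C}
    (hp : IsFPSurjective p.hom) (i j : ℤ) :
    IsFPSurjective (((single _ (ComplexShape.up ℤ) i).map p).f j).hom := by
  intro F _ _ _ y
  obtain rfl | hj := eq_or_ne j i
  · obtain ⟨w, hw⟩ := hp F ((singleObjXSelf (ComplexShape.up ℤ) j C).hom.hom ∘ₗ y)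
    refine ⟨(singleObjXSelf (ComplexShape.up ℤ) j B).inv.hom ∘ₗ w, LinearMap.ext fun x => ?_⟩
    have hwx : p (w x) = (singleObjXSelf (ComplexShape.up ℤ) j C).hom (y x) :=
      LinearMap.congr_fun hw x
    simp [single_map_f_self, hwx]
  · have := ModuleCat.subsingleton_of_isZero (isZero_single_obj_X (ComplexShape.up ℤ) i C j hj)
    exact ⟨0, LinearMap.ext fun _ => Subsingleton.elim _ _⟩

namespace IsCofibrant

variable {P : CochainComplex (ModuleCat.{u} R) ℤ} (hP : IsCofibrant P)

include hP

theorem homotopy_zero {Y : CochainComplex (ModuleCat.{u} R) ℤ} (hY : IsFPAcyclic Y) (z : P ⟶ Y) :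
    Nonempty (Homotopy z 0) := by
  obtain ⟨l, rfl⟩ := hP _ (isFPTrivialFibration_mappingCocone_fst hY) z
  exact ⟨(Homotopy.ofEq (by simp)).trans ((((homotopyMappingCoconeIdZero Y).compLeft l).compRight
    (mappingCocone.fst (𝟙 Y))).trans (Homotopy.ofEq (by simp)))⟩

theorem exists_δ_eq {Y : CochainComplex (ModuleCat.{u} R) ℤ} (hY : IsFPAcyclic Y) {m n : ℤ}
    (hmn : m + 1 = n) (φ : Cocycle P Y n) : ∃ ψ : Cochain P Y m, δ m n ψ = φ.1 := by
  obtain ⟨z, rfl⟩ := Cocycle.equivHomShift.surjective φ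
  obtain ⟨h⟩ := hP.homotopy_zero (hY.shift n) z
  obtain ⟨γ, hγ⟩ := Cochain.equivHomotopy _ _ h
  refine ⟨n.negOnePow • γ.rightUnshift m (by lia), ?_⟩
  rw [δ_units_smul, Cochain.δ_rightUnshift _ _ _ _ 0 (zero_add n), smul_smul,
    Int.units_mul_self, one_smul]
  rw [Cochain.ofHom_zero, add_zero] at hγ
  rw [← hγ, Cocycle.equivHomShift_apply]
  rfl

theorem exists_cochain_comp_eq {K L : CochainComplex (ModuleCat.{u} R) ℤ} {g : K ⟶ L}
    (hg : ∀ i, IsFPSurjective (g.f i).hom) (β : Cochain P L 0) :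
    ∃ γ : Cochain P K 0, γ.comp (Cochain.ofHom g) (add_zero 0) = β := by
  -- `0`-cochains into `L` are the second components of cochain maps into the cone of `𝟙 L`.
  let l : P ⟶ mappingCone (𝟙 L) := mappingCone.lift (𝟙 L)
    (-Cocycle.mk (δ 0 1 β) 2 rfl (δ_δ _ _ _ _)) β (by simp)
  obtain ⟨k, hk⟩ := hP _ (isFPTrivialFibration_mappingConeIdMap hg) l
  refine ⟨(Cochain.ofHom k).comp (mappingCone.snd (𝟙 K)) (add_zero 0), ?_⟩
  rw [Cochain.comp_assoc_of_second_is_zero_cochain, snd_comp_ofHom,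
    ← Cochain.comp_assoc_of_first_is_zero_cochain, ← Cochain.ofHom_comp, hk]
  exact mappingCone.lift_snd (𝟙 L) _ _ _

theorem isPureProjective (i : ℤ) : IsPureProjective (P.X i) := by
  intro S hS h
  obtain ⟨γ, hγ⟩ := hP.exists_cochain_comp_eq
    (isFPSurjective_single_map_f ((isPureShortExact_iff hS.1).1 hS) i)
    (Cochain.single (h ≫ (singleObjXSelf (ComplexShape.up ℤ) i S.X₃).inv) 0)
  refine ⟨γ.v i i (add_zero i) ≫ (singleObjXSelf _ i _).hom, ?_⟩
  have hγi := Cochain.congr_v hγ i i (add_zero i)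
  rw [Cochain.comp_zero_cochain_v, Cochain.ofHom_v, Cochain.single_v, single_map_f_self] at hγi
  simpa [← Category.assoc] using hγi

end IsCofibrant

end Cochains

/-! ### The Hom complex -/

section HomComplex

open TensorProduct CochainComplex.HomComplex

theorem finitePresentation_tensorProduct (k A F G : Type*) [CommRing k] [Ring A] [Algebra k A]
    [AddCommGroup F] [Module k F] [Module A F] [IsScalarTower k A F] [AddCommGroup G] [Module k G]
    [Module.FinitePresentation A F] [Module.FinitePresentation k G] :
    Module.FinitePresentation A (F ⊗[k] G) := by
  obtain ⟨n, m, f, g, hf, hgf⟩ := Module.FinitePresentation.exists_fin' k G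
  have free (l : ℕ) : Module.FinitePresentation A (F ⊗[k] (Fin l → k)) :=
    .of_equiv (((AlgebraTensorModule.congr (.refl A F)
      (Finsupp.linearEquivFunOnFinite k k (Fin l)).symm).trans
        (finsuppScalarRight k A F (Fin l))).trans
          (Finsupp.linearEquivFunOnFinite A F (Fin l))).symm
  refine Module.finitePresentation_of_surjective (AlgebraTensorModule.lTensor A F f)
    (LinearMap.lTensor_surjective F hf) ?_
  have hker : LinearMap.ker (AlgebraTensorModule.lTensor A F f) =
      LinearMap.range (AlgebraTensorModule.lTensor A F g) :=
    (LinearMap.exact_iff (f := AlgebraTensorModule.lTensor A F g)).1 (lTensor_exact F hgf hf)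
  rw [hker]
  exact Submodule.FG.of_finite

variable {R : Type v} [Ring R] {G : Type} [AddCommGroup G]
  {P Y : CochainComplex (ModuleCat.{u} R) ℤ}

variable (G Y) in
/-- The complex of left `R`-modules `Hom_ℤ(G, Y)`, with `R` acting through `Y`. -/
def intHomComplex : CochainComplex (ModuleCat.{u} R) ℤ where
  X i := ModuleCat.of R (G →ₗ[ℤ] Y.X i)
  d i j := ModuleCat.ofHom
    { toFun φ := (Y.d i j).hom.restrictScalars ℤ ∘ₗ φ
      map_add' _ _ := LinearMap.comp_add _ _ _
      map_smul' _ _ := LinearMap.ext fun _ => (Y.d i j).hom.map_smul _ _ }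
  shape i j h := ModuleCat.hom_ext <| LinearMap.ext fun φ => LinearMap.ext fun g =>
    ConcreteCategory.congr_hom (Y.shape i j h) (φ g)
  d_comp_d' i j k _ _ := ModuleCat.hom_ext <| LinearMap.ext fun φ => LinearMap.ext fun g =>
    ConcreteCategory.congr_hom (Y.d_comp_d i j k) (φ g)

theorem isFPAcyclic_intHomComplex (hY : IsFPAcyclic Y) [Module.FinitePresentation ℤ G] :
    IsFPAcyclic (intHomComplex G Y) := by
  intro i j k hij hjk F _ _ _ z hz
  have := finitePresentation_tensorProduct ℤ R F G
  obtain ⟨w, hw⟩ := hY hij hjk (F ⊗[ℤ] G)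
    (AlgebraTensorModule.lift (z : F →ₗ[R] G →ₗ[ℤ] Y.X j))
    (AlgebraTensorModule.ext fun x g => LinearMap.congr_fun (LinearMap.congr_fun hz x) g)
  exact ⟨AlgebraTensorModule.curry w, LinearMap.ext fun x => LinearMap.ext fun g =>
    (LinearMap.congr_fun hw (x ⊗ₜ g)).trans (AlgebraTensorModule.lift_tmul _ _ _)⟩

variable (Y) in
/-- Evaluation at `g`, as a cochain map `Hom_ℤ(G, Y) → Y`. -/
def intHomEval (g : G) : intHomComplex G Y ⟶ Y where
  f i := ModuleCat.ofHom (X := G →ₗ[ℤ] Y.X i)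
    { toFun φ := φ g
      map_add' _ _ := rfl
      map_smul' _ _ := rfl }

theorem intHomEval_add (g g' : G) :
    intHomEval Y (g + g') = intHomEval Y g + intHomEval Y g' :=
  HomologicalComplex.hom_ext _ _ fun i => ModuleCat.hom_ext <|
    LinearMap.ext fun φ : G →ₗ[ℤ] Y.X i => map_add φ g g'

/-- The cochain `P → Hom_ℤ(G, Y)` adjoint to a homomorphism from `G` to the cochains `P → Y`. -/
def cochainOfAddMonoidHom {n : ℤ} (z : G →+ Cochain P Y n) : Cochain P (intHomComplex G Y) n :=
  Cochain.mk fun p q h => ModuleCat.ofHom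
    { toFun x := AddMonoidHom.toIntLinearMap
        { toFun g := (z g).v p q h x
          map_zero' := by rw [map_zero]; rfl
          map_add' g g' := by rw [map_add]; rfl }
      map_add' x x' := LinearMap.ext fun g => map_add ((z g).v p q h).hom x x'
      map_smul' a x := LinearMap.ext fun g => map_smul ((z g).v p q h).hom a x }

theorem cochainOfAddMonoidHom_comp_intHomEval {n : ℤ} (z : G →+ Cochain P Y n) (g : G) :
    (cochainOfAddMonoidHom z).comp (Cochain.ofHom (intHomEval Y g)) (add_zero n) = z g := by
  ext p q h x
  rw [Cochain.comp_zero_cochain_v]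
  rfl

theorem cochain_intHomComplex_ext {n : ℤ} {φ ψ : Cochain P (intHomComplex G Y) n}
    (h : ∀ g, φ.comp (Cochain.ofHom (intHomEval Y g)) (add_zero n) =
      ψ.comp (Cochain.ofHom (intHomEval Y g)) (add_zero n)) : φ = ψ := by
  ext p q hpq x
  refine LinearMap.ext fun g => ?_
  have hg := ConcreteCategory.congr_hom (Cochain.congr_v (h g) p q hpq) x
  rwa [Cochain.comp_zero_cochain_v, Cochain.comp_zero_cochain_v] at hg

theorem IsCofibrant.isFPAcyclic_homComplex (hP : IsCofibrant P) (hY : IsFPAcyclic Y) :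
    IsFPAcyclic (homComplex P Y) := by
  intro i j k hij hjk G _ _ _ z hz
  obtain rfl : ‹Module ℤ G› = AddCommGroup.toIntModule G := Subsingleton.elim _ _
  let z' : G →+ Cochain P Y j := z.toAddMonoidHom
  have hφ : δ j k (cochainOfAddMonoidHom z') = 0 := cochain_intHomComplex_ext fun g => by
    rw [← δ_comp_ofHom, cochainOfAddMonoidHom_comp_intHomEval, Cochain.zero_comp]
    exact LinearMap.congr_fun hz g
  obtain ⟨ψ, hψ⟩ :=
    hP.exists_δ_eq (isFPAcyclic_intHomComplex (G := G) hY) hij (Cocycle.mk _ k hjk hφ)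
  let w : G →+ Cochain P Y i :=
    AddMonoidHom.mk' (fun g => ψ.comp (Cochain.ofHom (intHomEval Y g)) (add_zero i)) fun g g' => by
      rw [intHomEval_add, Cochain.ofHom_add, Cochain.comp_add]
  refine ⟨w.toIntLinearMap, LinearMap.ext fun g => ?_⟩
  change δ i j (ψ.comp (Cochain.ofHom (intHomEval Y g)) (add_zero i)) = z g
  rw [δ_comp_ofHom, hψ]
  exact cochainOfAddMonoidHom_comp_intHomEval _ g

end HomComplex

end PureComplex

theorem theorem5p1_general {R : Type u} [Ring R] (X : CochainComplex (ModuleCat.{u} R) ℤ) :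
    ∃ (P : CochainComplex (ModuleCat.{u} R) ℤ) (f : P ⟶ X),
      PureComplex.IsPureProjectiveResolution f := by
  obtain ⟨P, f, hP, hf⟩ := PureComplex.exists_isCofibrant_isFPTrivialFibration X
  exact ⟨P, f,
    { pureProjective := hP.isPureProjective
      pureQuasiIso := PureComplex.isPureExact_iff.2 hf.isFPAcyclic_mappingCone
      preserves := fun _ hY => PureComplex.isPureExact_iff.2
        (hP.isFPAcyclic_homComplex (PureComplex.isPureExact_iff.1 hY)) }⟩

theorem theorem5p1 {R : Type u} [Ring R] (X : CochainComplex (ModuleCat.{u} R) ℤ)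
    (hX : ∃ n : ℤ, ∀ i : ℤ, i < n → IsZero (X.X i)) :
    ∃ (P : CochainComplex (ModuleCat.{u} R) ℤ) (f : P ⟶ X),
      PureComplex.IsPureProjectiveResolution f :=
  theorem5p1_general X
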